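/- Let $\Omega=C_0(\mathbb R^+)$ be the space of continuous paths $\omega:[0,\infty)\to\mathbb R$ with $\omega_0=0$, with the topology of locally uniform convergence and its Borel $\sigma$-algebra $\mathcal B(\Omega)$. For $t\ge 0$ let $\mathcal F_t$ be the $\sigma$-algebra on $\Omega$ consisting of the preimages of Borel sets under $\omega\mapsto\omega_{\cdot\wedge t}$. Let $\mathcal P$ be a nonempty set of probability measures on $(\Omega,\mathcal B(\Omega))$ (for instance the weakly compact set that represents the $G$-expectation), and let $\hat{\mathbb E}[\xi]=\sup_{P\in\mathcal P}E_P[\xi]$. Fix $p\ge 1$ and $0<T<\infty$. Let $M_{b,0}(0,T)$ be the set of simple processes $\eta_t(\omega)=\sum_{j=0}^{N-1}\xi_j(\omega)\mathbf 1_{[t_j,t_{j+1})}(t)$ on $[0,T]$ with $N>0$, $0=t_0<\dots<t_N=T$ and each $\xi_j$ bounded and $\mathcal F_{t_j}$-measurable. Let $M_*^p(0,T)$ be the completion of $M_{b,0}(0,T)$ under $\|\eta\|_{M^p(0,T)}=\big(\hat{\mathbb E}\big[\int_0^T|\eta_t|^p\,dt\big]\big)^{1/p}$, realized by processes: a process $X:[0,T]\times\Omega\to\mathbb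 R$ lies in $M_*^p(0,T)$ if and only if it is $\mathcal B([0,T])\otimes\mathcal B(\Omega)$-measurable and there are $Y^{(n)}\in M_{b,0}(0,T)$ with $\|X-Y^{(n)}\|_{M^p(0,T)}\to 0$; processes whose difference has norm zero represent the same element. Let $\tau:\Omega\to[0,T]$ be a stopping time, i.e. $\{\tau\le t\}\in\mathcal F_t$ for every $t\ge 0$. Then for every $X\in M_*^p(0,T)$ the process $(t,\omega)\mapsto\mathbf 1_{[0,\tau(\omega)]}(t)\,X_t(\omega)$ lies in $M_*^p(0,T)$. -/

import Mathlib

open MeasureTheory ProbabilityTheory Filter Topology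
open scoped NNReal ENNReal

/-- The path space `Ω = C₀(ℝ⁺)`: continuous `ω : [0,∞) → ℝ` with `ω 0 = 0`. -/
def PathSpace : Type := {ω : C(ℝ≥0, ℝ) // ω 0 = 0}

namespace PathSpace

/-- The topology of locally uniform convergence (the compact-open topology), which is the one
induced by the distance `ρ(ω, ω') = ∑ 2⁻ⁱ (max_{t ≤ i} |ω t - ω' t| ∧ 1)`. -/
instance : TopologicalSpace PathSpace :=
  inferInstanceAs (TopologicalSpace {ω : C(ℝ≥0, ℝ) // ω 0 = 0})

/-- The Borel `σ`-algebra `𝓑(Ω)`. -/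
instance instMeasurableSpace : MeasurableSpace PathSpace := borel PathSpace

instance : BorelSpace PathSpace := ⟨rfl⟩

/-- The stopped path `ω_{· ∧ t}`. -/
def stopPath (t : ℝ≥0) (ω : PathSpace) : PathSpace :=
  ⟨ω.1.comp ⟨fun s => min s t, by fun_prop⟩, by
    have h : min (0 : ℝ≥0) t = 0 := min_eq_left t.2
    simpa [h] using ω.2⟩

lemma continuous_stopPath (t : ℝ≥0) : Continuous (stopPath t) :=
  Continuous.subtype_mk ((ContinuousMap.continuous_precomp _).comp continuous_subtype_val) _

lemma stopPath_stopPath {s t : ℝ≥0} (h : s ≤ t) (ω : PathSpace) : stopPath s (stopPath t ω) = stopPath s ω := by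
  apply Subtype.ext
  ext u
  simp [stopPath, min_assoc, min_eq_left h]

/-- The filtration `𝓕_t = 𝓑(Ω_t)`, `Ω_t = {ω_{· ∧ t} : ω ∈ Ω}`, as `σ`-algebras on `Ω`: the
`𝓕_t`-measurable sets are the preimages of the Borel sets under `ω ↦ ω_{· ∧ t}`. -/
def filtration : Filtration ℝ≥0 instMeasurableSpace where
  seq t := instMeasurableSpace.comap (stopPath t)
  mono' s t h := by
    rintro A ⟨B, hB, rfl⟩
    refine ⟨stopPath s ⁻¹' B, (continuous_stopPath s).measurable hB, ?_⟩
    ext ω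
    simp [stopPath_stopPath h]
  le' t := (continuous_stopPath t).measurable.comap_le

end PathSpace

/-- The upper expectation `Ê[ξ] = sup_{P ∈ Ps} E_P[ξ]` of a nonnegative random variable `ξ`. -/
noncomputable def upperExpectation (Ps : Set (ProbabilityMeasure PathSpace))
    (ξ : PathSpace → ℝ≥0∞) : ℝ≥0∞ :=
  ⨆ P ∈ Ps, ∫⁻ ω, ξ ω ∂(P : Measure PathSpace)

/-- The norm `‖η‖_{M^p(0,T)} = (Ê[∫₀ᵀ |η_t|^p dt])^{1/p}` of a process on `[0,T]`. Processes are
written as functions on `ℝ × Ω`, of which only the values on `[0,T] × Ω` are ever used. -/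
noncomputable def processNorm (Ps : Set (ProbabilityMeasure PathSpace)) (p : ℝ) (T : ℝ≥0)
    (η : ℝ → PathSpace → ℝ) : ℝ≥0∞ :=
  (upperExpectation Ps fun ω => ∫⁻ t in Set.Icc (0 : ℝ) T, ‖η t ω‖ₑ ^ p) ^ (1 / p)

/-- The space `M_{b,0}(0,T)` of simple processes `η_t(ω) = ∑_{j < N} ξ_j(ω) 1_{[t_j, t_{j+1})}(t)`
with `N > 0`, `0 = t_0 < ⋯ < t_N = T` and `ξ_j` bounded and `𝓕_{t_j}`-measurable. -/
def IsSimpleProcess (T : ℝ≥0) (η : ℝ → PathSpace → ℝ) : Prop :=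
  ∃ (N : ℕ) (t : ℕ → ℝ≥0) (ξ : ℕ → PathSpace → ℝ),
    0 < N ∧ t 0 = 0 ∧ t N = T ∧ (∀ j < N, t j < t (j + 1)) ∧
    (∀ j < N, Measurable[PathSpace.filtration (t j)] (ξ j) ∧ ∃ C : ℝ, ∀ ω, |ξ j ω| ≤ C) ∧
    ∀ s ∈ Set.Icc (0 : ℝ) T, ∀ ω,
      η s ω = ∑ j ∈ Finset.range N,
        (Set.Ico (t j : ℝ) (t (j + 1))).indicator (fun _ => ξ j ω) s

/-- The space `M_*^p(0,T)`, the completion of `M_{b,0}(0,T)` under `‖·‖_{M^p(0,T)}`, realized by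
processes: `X` represents an element of the completion iff it is jointly measurable on `[0,T] × Ω`
and is the limit in `‖·‖_{M^p(0,T)}` of a sequence in `M_{b,0}(0,T)`. (Two processes represent the
same element iff their difference has norm zero.) -/
def MemMStar (Ps : Set (ProbabilityMeasure PathSpace)) (p : ℝ) (T : ℝ≥0)
    (X : ℝ → PathSpace → ℝ) : Prop :=
  Measurable (fun z : Set.Icc (0 : ℝ) T × PathSpace => X z.1 z.2) ∧
  ∃ Y : ℕ → ℝ → PathSpace → ℝ, (∀ n, IsSimpleProcess T (Y n)) ∧
    Tendsto (fun n => processNorm Ps p T (fun t ω => X t ω - Y n t ω)) atTop (𝓝 0)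

/-- The process `1_{[0,τ]} X`, i.e. `(t, ω) ↦ 1_{[0, τ(ω)]}(t) X_t(ω)`. -/
noncomputable def stoppedIndicator (τ : PathSpace → ℝ≥0) (X : ℝ → PathSpace → ℝ) :
    ℝ → PathSpace → ℝ :=
  fun t ω => (Set.Icc (0 : ℝ) (τ ω)).indicator (fun s => X s ω) t

/-! Multiplication by `1_{[0,τ]}` does not increase `|X - Y|`, so it suffices to approximate
`1_{[0,τ]} Y` for simple `Y`. Refine the grid of `Y` to a grid `s` of mesh at most `T / k`, on whose
cells `Y` is still constant, and on `[s i, s (i + 1))` replace the condition `u ≤ τ` by `s i ≤ τ`.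
The new coefficients are known at time `s i`, and the error is bounded by `C` and lives on `[τ, τ +
T / k]` (`IsSimpleProcess.exists_approx_stoppedIndicator`). Its time integral is therefore at most
`C ^ p * T / k` along every path, a bound that survives the supremum over `Ps` without any
regularity of `τ` in `ω` (`upperExpectation_stoppedIndicator_sub_le`). -/

section Partition

/-- The points cutting each interval `[t j, t (j + 1))` into `k` pieces of equal length. -/
noncomputable def refinePartition (t : ℕ → ℝ≥0) (k i : ℕ) : ℝ≥0 :=
  t (i / k) + ((i % k : ℕ) : ℝ≥0) / k * (t (i / k + 1) - t (i / k))

lemma refinePartition_mul (t : ℕ → ℝ≥0) {k : ℕ} (hk : 0 < k) (j : ℕ) :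
    refinePartition t k (j * k) = t j := by
  simp [refinePartition, Nat.mul_div_cancel _ hk]

lemma refinePartition_succ {t : ℕ → ℝ≥0} {k i : ℕ} (hk : 0 < k)
    (h : t (i / k) ≤ t (i / k + 1)) :
    refinePartition t k (i + 1) =
      refinePartition t k i + (t (i / k + 1) - t (i / k)) / k := by
  have hk0 : (k : ℝ≥0) ≠ 0 := by exact_mod_cast hk.ne'
  obtain hlt | heq := (Nat.succ_le_of_lt (Nat.mod_lt i hk)).lt_or_eq
  · have hd : (i + 1) / k = i / k := by
      rw [Nat.div_eq_iff hk]
      have := Nat.div_add_mod i k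
      have h' : i / k * k = k * (i / k) := mul_comm _ _
      omega
    have hm : (i + 1) % k = i % k + 1 := by
      have h₁ := Nat.div_add_mod i k
      have h₂ := Nat.div_add_mod (i + 1) k
      rw [hd] at h₂
      omega
    simp only [refinePartition, hd, hm]
    push_cast
    ring
  -- Last piece of a block: the index `i + 1` already belongs to the next block.
  · have hi : i + 1 = (i / k + 1) * k := by
      have := Nat.div_add_mod i k
      rw [add_mul, mul_comm (i / k) k]
      omega
    have hm : ((i % k : ℕ) : ℝ≥0) + 1 = k := by exact_mod_cast heq
    rw [hi, refinePartition_mul t hk, refinePartition]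
    calc t (i / k + 1) = t (i / k) + (t (i / k + 1) - t (i / k)) := (add_tsub_cancel_of_le h).symm
      _ = t (i / k) + ((((i % k : ℕ) : ℝ≥0) + 1) / k) * (t (i / k + 1) - t (i / k)) := by
        rw [hm, div_self hk0, one_mul]
      _ = _ := by ring

lemma le_refinePartition (t : ℕ → ℝ≥0) (k i : ℕ) : t (i / k) ≤ refinePartition t k i :=
  le_self_add

lemma refinePartition_succ_le {t : ℕ → ℝ≥0} {k i : ℕ} (hk : 0 < k)
    (h : t (i / k) ≤ t (i / k + 1)) : refinePartition t k (i + 1) ≤ t (i / k + 1) := by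
  have hk0 : (k : ℝ≥0) ≠ 0 := by exact_mod_cast hk.ne'
  rw [refinePartition_succ hk h, refinePartition]
  calc _ = t (i / k) + ((((i % k : ℕ) : ℝ≥0) + 1) / k) * (t (i / k + 1) - t (i / k)) := by ring
    _ ≤ t (i / k) + 1 * (t (i / k + 1) - t (i / k)) := by
      gcongr
      refine div_le_one_of_le₀ ?_ (by positivity)
      exact_mod_cast Nat.succ_le_of_lt (Nat.mod_lt i hk)
    _ = t (i / k + 1) := by rw [one_mul, add_tsub_cancel_of_le h]

lemma le_of_forall_lt_succ {t : ℕ → ℝ≥0} {N : ℕ} (ht : ∀ j < N, t j < t (j + 1)) {a b : ℕ}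
    (hab : a ≤ b) (hb : b ≤ N) : t a ≤ t b := by
  induction b, hab using Nat.le_induction with
  | base => exact le_rfl
  | succ b hab ih => exact (ih (by omega)).trans (ht b (by omega)).le

lemma exists_mem_Ico_of_partition {t : ℕ → ℝ≥0} {N : ℕ} (h0 : t 0 = 0) {u : ℝ} (hu : 0 ≤ u)
    (huN : u < t N) : ∃ i < N, u ∈ Set.Ico (t i : ℝ) (t (i + 1)) := by
  induction N with
  | zero => simp [h0] at huN; linarith
  | succ N ih =>
    by_cases h : u < t N
    · obtain ⟨i, hi, hiu⟩ := ih h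
      exact ⟨i, by omega, hiu⟩
    · exact ⟨N, by omega, not_lt.1 h, huN⟩

lemma sum_indicator_Ico_of_mem {t : ℕ → ℝ≥0} {N : ℕ} (ht : ∀ j < N, t j < t (j + 1)) (ξ : ℕ → ℝ)
    {u : ℝ} {i : ℕ} (hi : i < N) (hu : u ∈ Set.Ico (t i : ℝ) (t (i + 1))) :
    ∑ j ∈ Finset.range N, (Set.Ico (t j : ℝ) (t (j + 1))).indicator (fun _ => ξ j) u = ξ i := by
  rw [Finset.sum_eq_single i]
  · simp [Set.indicator_of_mem hu]
  · intro j hj hji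
    rw [Finset.mem_range] at hj
    refine Set.indicator_of_notMem (fun hju => ?_) _
    obtain h | h := lt_or_gt_of_ne hji
    · have := le_of_forall_lt_succ ht (Nat.succ_le_of_lt h) hi.le
      exact absurd (hju.2.trans_le (NNReal.coe_le_coe.2 this)) (not_lt.2 hu.1)
    · have := le_of_forall_lt_succ ht (Nat.succ_le_of_lt h) hj.le
      exact absurd (hu.2.trans_le (NNReal.coe_le_coe.2 this)) (not_lt.2 hju.1)
  · simp [hi]

lemma sum_indicator_Ico_of_le {t : ℕ → ℝ≥0} {N : ℕ} (ht : ∀ j < N, t j < t (j + 1)) (ξ : ℕ → ℝ)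
    {u : ℝ} (hu : (t N : ℝ) ≤ u) :
    ∑ j ∈ Finset.range N, (Set.Ico (t j : ℝ) (t (j + 1))).indicator (fun _ => ξ j) u = 0 := by
  refine Finset.sum_eq_zero fun j hj => Set.indicator_of_notMem (fun hju => ?_) _
  rw [Finset.mem_range] at hj
  have := le_of_forall_lt_succ ht (Nat.succ_le_of_lt hj) le_rfl
  exact absurd (hju.2.trans_le (NNReal.coe_le_coe.2 this)) (not_lt.2 hu)

end Partition

/-- Stopping a simple process at `τ` agrees with a simple process outside a short time interval
following `τ`. -/
lemma IsSimpleProcess.exists_approx_stoppedIndicator {T : ℝ≥0} {η : ℝ → PathSpace → ℝ}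
    (hη : IsSimpleProcess T η) {τ : PathSpace → ℝ≥0}
    (hτ : IsStoppingTime PathSpace.filtration (fun ω => (τ ω : WithTop ℝ≥0))) :
    ∃ C : ℝ≥0, ∀ k : ℕ, 0 < k → ∃ ζ, IsSimpleProcess T ζ ∧ ∀ ω, ∀ u ∈ Set.Icc (0 : ℝ) T,
      ‖stoppedIndicator τ η u ω - ζ u ω‖ₑ ≤
        (Set.Icc (τ ω : ℝ) (τ ω + T / k)).indicator (fun _ => (C : ℝ≥0∞)) u := by
  classical
  obtain ⟨N, t, ξ, hN, h0, hT, ht, hξ, hsum⟩ := hη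
  have hbdd : ∃ C : ℝ≥0, ∀ j < N, ∀ ω, |ξ j ω| ≤ C := by
    choose! hm C hC using hξ
    refine ⟨∑ j ∈ Finset.range N, (C j).toNNReal, fun j hj ω => (hC j hj ω).trans ?_⟩
    refine (Real.le_coe_toNNReal _).trans (NNReal.coe_le_coe.2 ?_)
    exact Finset.single_le_sum (f := fun j => (C j).toNNReal) (fun _ _ => zero_le)
      (Finset.mem_range.2 hj)
  obtain ⟨C, hC⟩ := hbdd
  refine ⟨C, fun k hk => ?_⟩
  have hk0 : (0 : ℝ≥0) < k := by exact_mod_cast hk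
  set s := refinePartition t k with hs_def
  have hdiv : ∀ i < N * k, i / k < N := fun i hi => (Nat.div_lt_iff_lt_mul hk).2 hi
  have hs0 : s 0 = 0 := by simpa [h0] using refinePartition_mul t hk 0
  have hsN : s (N * k) = T := by rw [hs_def, refinePartition_mul t hk, hT]
  have hsucc : ∀ i < N * k, s (i + 1) = s i + (t (i / k + 1) - t (i / k)) / k := fun i hi =>
    refinePartition_succ hk (ht _ (hdiv i hi)).le
  have hs : ∀ i < N * k, s i < s (i + 1) := fun i hi => by
    rw [hsucc i hi]
    exact lt_add_of_pos_right _ (div_pos (tsub_pos_of_lt (ht _ (hdiv i hi))) hk0)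
  have hmesh : ∀ i < N * k, s (i + 1) ≤ s i + T / k := fun i hi => by
    rw [hsucc i hi]
    gcongr
    refine tsub_le_self.trans ?_
    rw [← hT]
    exact le_of_forall_lt_succ ht (Nat.succ_le_of_lt (hdiv i hi)) le_rfl
  set ζ' : ℕ → PathSpace → ℝ := fun i => {ω | s i ≤ τ ω}.indicator (ξ (i / k)) with hζ'
  refine ⟨fun u ω => ∑ j ∈ Finset.range (N * k),
      (Set.Ico (s j : ℝ) (s (j + 1))).indicator (fun _ => ζ' j ω) u,
    ⟨N * k, s, ζ', Nat.mul_pos hN hk, hs0, hsN, hs, fun i hi => ⟨?_, C, fun ω => ?_⟩,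
      fun _ _ _ => rfl⟩, fun ω u hu => ?_⟩
  · refine Measurable.indicator ?_ ?_
    · exact (hξ _ (hdiv i hi)).1.mono (PathSpace.filtration.mono (le_refinePartition t k i)) le_rfl
    -- `{s i ≤ τ}` is the complement of `{τ < s i}`, hence known at time `s i`.
    · have := (hτ.measurableSet_lt (s i)).compl
      convert this using 1
      ext ω
      exact not_lt.symm.trans (not_congr (WithTop.coe_lt_coe (α := ℝ≥0)).symm)
  · by_cases h : s i ≤ τ ω
    · simpa [hζ', Set.indicator, h] using hC _ (hdiv i hi) ω
    · simp [hζ', h]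
  · beta_reduce
    obtain hlt | hge := lt_or_ge u T
    · rw [← hsN] at hlt
      obtain ⟨i, hi, hiu⟩ := exists_mem_Ico_of_partition hs0 hu.1 hlt
      have hηu : η u ω = ξ (i / k) ω := by
        rw [hsum u hu ω]
        refine sum_indicator_Ico_of_mem ht (fun j => ξ j ω) (hdiv i hi) ⟨?_, ?_⟩
        · exact (NNReal.coe_le_coe.2 (le_refinePartition t k i)).trans hiu.1
        · exact hiu.2.trans_le
            (NNReal.coe_le_coe.2 (refinePartition_succ_le hk (ht _ (hdiv i hi)).le))
      rw [sum_indicator_Ico_of_mem hs (fun j => ζ' j ω) hi hiu]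
      by_cases huτ : u ≤ τ ω
      · have : s i ≤ τ ω := NNReal.coe_le_coe.1 (hiu.1.trans huτ)
        simp [stoppedIndicator, hζ', Set.indicator, this, huτ, hu.1, hηu]
      -- The two processes can differ only when `s i ≤ τ < u`, which puts `u` within one mesh of
      -- `τ`.
      · by_cases hsτ : s i ≤ τ ω
        · have h₁ : u ≤ τ ω + T / k := by
            have h₂ : (s (i + 1) : ℝ) ≤ τ ω + T / k := by
              exact_mod_cast (hmesh i hi).trans (add_le_add_left hsτ _)
            exact hiu.2.le.trans h₂
          have hmem : u ∈ Set.Icc (τ ω : ℝ) (τ ω + T / k) := ⟨(not_le.1 huτ).le, h₁⟩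
          rw [Set.indicator_of_mem hmem]
          simp only [stoppedIndicator, hζ', Set.indicator, Set.mem_Icc, huτ, and_false, if_false,
            Set.mem_ofPred_eq, hsτ, if_true, zero_sub, enorm_neg]
          rw [enorm_le_coe]
          exact NNReal.coe_le_coe.1 (hC _ (hdiv i hi) ω)
        · simp [stoppedIndicator, hζ', Set.indicator, huτ, hsτ]
    -- At the endpoint `u = T` both simple processes vanish, since their last interval is half-open.
    · have hηu : η u ω = 0 := by
        rw [hsum u hu ω]
        exact sum_indicator_Ico_of_le ht (fun j => ξ j ω) (by rwa [hT])
      rw [sum_indicator_Ico_of_le hs (fun j => ζ' j ω) (by rwa [hsN])]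
      simp [stoppedIndicator, Set.indicator, hηu]

/-- Convexity, `(a + b) ^ p ≤ 2 ^ (p - 1) * (a ^ p + b ^ p)`, gives the estimate path by path,
because the error interval has length `δ` wherever `τ` falls. Additivity of the integral needs only
the error term to be measurable, so nothing is asked of `X` and `Y`. -/
lemma upperExpectation_stoppedIndicator_sub_le (Ps : Set (ProbabilityMeasure PathSpace))
    {p : ℝ} (hp : 1 ≤ p) (T : ℝ≥0) (τ : PathSpace → ℝ≥0) (X Y ζ : ℝ → PathSpace → ℝ)
    (C δ : ℝ≥0)
    (h : ∀ ω, ∀ u ∈ Set.Icc (0 : ℝ) T, ‖stoppedIndicator τ Y u ω - ζ u ω‖ₑ ≤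
        (Set.Icc (τ ω : ℝ) (τ ω + δ)).indicator (fun _ => (C : ℝ≥0∞)) u) :
    upperExpectation Ps (fun ω => ∫⁻ t in Set.Icc (0 : ℝ) T,
        ‖stoppedIndicator τ X t ω - ζ t ω‖ₑ ^ p) ≤
      2 ^ (p - 1) * (upperExpectation Ps (fun ω => ∫⁻ t in Set.Icc (0 : ℝ) T,
        ‖X t ω - Y t ω‖ₑ ^ p) + (C : ℝ≥0∞) ^ p * δ) := by
  have hp0 : 0 < p := by linarith
  have h2 : (2 : ℝ≥0∞) ^ (p - 1) ≠ ∞ := ENNReal.rpow_ne_top_of_nonneg (by linarith) (by simp)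
  have key : ∀ ω, ∫⁻ t in Set.Icc (0 : ℝ) T, ‖stoppedIndicator τ X t ω - ζ t ω‖ₑ ^ p ≤
      2 ^ (p - 1) * ((∫⁻ t in Set.Icc (0 : ℝ) T, ‖X t ω - Y t ω‖ₑ ^ p) +
        (C : ℝ≥0∞) ^ p * δ) := fun ω => by
    set I := Set.Icc (τ ω : ℝ) (τ ω + δ)
    calc _ ≤ ∫⁻ t in Set.Icc (0 : ℝ) T, 2 ^ (p - 1) * (‖X t ω - Y t ω‖ₑ ^ p +
            I.indicator (fun _ => (C : ℝ≥0∞) ^ p) t) := by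
          refine setLIntegral_mono' measurableSet_Icc fun u hu => ?_
          have hXY : ‖stoppedIndicator τ X u ω - stoppedIndicator τ Y u ω‖ₑ ≤
              ‖X u ω - Y u ω‖ₑ := by
            by_cases hu' : u ∈ Set.Icc (0 : ℝ) (τ ω)
            · simp [stoppedIndicator, Set.indicator_of_mem hu']
            · simp [stoppedIndicator, Set.indicator_of_notMem hu']
          have hI : I.indicator (fun _ => (C : ℝ≥0∞) ^ p) u =
              I.indicator (fun _ => (C : ℝ≥0∞)) u ^ p := by
            by_cases hu' : u ∈ I
            · simp [Set.indicator_of_mem hu']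
            · simp [Set.indicator_of_notMem hu', hp0]
          rw [hI]
          refine le_trans ?_ (ENNReal.rpow_add_le_mul_rpow_add_rpow _ _ hp)
          gcongr
          rw [← sub_add_sub_cancel _ (stoppedIndicator τ Y u ω)]
          exact (enorm_add_le _ _).trans (add_le_add hXY (h ω u hu))
      _ ≤ _ := by
          have hm : Measurable (I.indicator (fun _ => (C : ℝ≥0∞) ^ p)) :=
            measurable_const.indicator measurableSet_Icc
          rw [lintegral_const_mul' _ _ h2, lintegral_add_right _ hm]
          gcongr
          refine (setLIntegral_le_lintegral _ _).trans ?_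
          rw [lintegral_indicator_const measurableSet_Icc, Real.volume_Icc]
          simp
  refine iSup₂_le fun P hP => ?_
  refine (lintegral_mono key).trans ?_
  rw [lintegral_const_mul' _ _ h2, lintegral_add_right _ measurable_const]
  simp only [lintegral_const, measure_univ, mul_one]
  gcongr
  exact le_iSup₂ (f := fun (P : ProbabilityMeasure PathSpace) (_ : P ∈ Ps) =>
    ∫⁻ ω, (∫⁻ t in Set.Icc (0 : ℝ) T, ‖X t ω - Y t ω‖ₑ ^ p) ∂(P : Measure PathSpace)) P hP

lemma measurable_of_isStoppingTime {τ : PathSpace → ℝ≥0}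
    (hτ : IsStoppingTime PathSpace.filtration (fun ω => (τ ω : WithTop ℝ≥0))) :
    Measurable τ := by
  refine measurable_of_Iic fun t => ?_
  have := PathSpace.filtration.le t _ (hτ t)
  convert this using 1
  ext ω
  exact (WithTop.coe_le_coe (α := ℝ≥0)).symm

lemma measurable_stoppedIndicator {T : ℝ≥0} {τ : PathSpace → ℝ≥0} (hτ : Measurable τ)
    {X : ℝ → PathSpace → ℝ}
    (hX : Measurable (fun z : Set.Icc (0 : ℝ) T × PathSpace => X z.1 z.2)) :
    Measurable (fun z : Set.Icc (0 : ℝ) T × PathSpace => stoppedIndicator τ X z.1 z.2) := by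
  have hS : MeasurableSet {z : Set.Icc (0 : ℝ) T × PathSpace | (z.1 : ℝ) ≤ τ z.2} :=
    measurableSet_le (measurable_subtype_coe.comp measurable_fst)
      (hτ.comp measurable_snd).coe_nnreal_real
  convert hX.indicator hS using 1
  ext z
  have := z.1.2.1
  simp [stoppedIndicator, Set.indicator, this]

theorem lemmat1 (Ps : Set (ProbabilityMeasure PathSpace)) (hPs : Ps.Nonempty)
    (p : ℝ) (hp : 1 ≤ p) (T : ℝ≥0) (hT : 0 < T)
    (τ : PathSpace → ℝ≥0) (hτT : ∀ ω, τ ω ≤ T)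
    (hτ : IsStoppingTime PathSpace.filtration (fun ω => (τ ω : WithTop ℝ≥0)))
    (X : ℝ → PathSpace → ℝ) (hX : MemMStar Ps p T X) :
    MemMStar Ps p T (stoppedIndicator τ X) := by
  obtain ⟨hXm, Y, hY, hlim⟩ := hX
  refine ⟨measurable_stoppedIndicator (measurable_of_isStoppingTime hτ) hXm, ?_⟩
  have hp0 : 0 < p := by linarith
  have h2 : (2 : ℝ≥0∞) ^ (p - 1) ≠ ∞ := ENNReal.rpow_ne_top_of_nonneg (by linarith) (by simp)
  set a : ℕ → ℝ≥0∞ := fun n => upperExpectation Ps (fun ω => ∫⁻ t in Set.Icc (0 : ℝ) T,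
    ‖X t ω - Y n t ω‖ₑ ^ p) with ha_def
  have ha : Tendsto a atTop (𝓝 0) := by
    have := (ENNReal.continuous_rpow_const (y := p)).tendsto 0 |>.comp hlim
    rw [ENNReal.zero_rpow_of_pos hp0] at this
    refine this.congr fun n => ?_
    simp only [Function.comp, processNorm]
    rw [← ENNReal.rpow_mul, one_div_mul_cancel hp0.ne', ENNReal.rpow_one]
  have hex : ∀ n, ∃ ζ, IsSimpleProcess T ζ ∧
      upperExpectation Ps (fun ω => ∫⁻ t in Set.Icc (0 : ℝ) T,
        ‖stoppedIndicator τ X t ω - ζ t ω‖ₑ ^ p) ≤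
      2 ^ (p - 1) * (a n + ((n : ℝ≥0∞) + 1)⁻¹) := fun n => by
    obtain ⟨C, hC⟩ := (hY n).exists_approx_stoppedIndicator hτ
    -- The bound `C` depends on `Y n`, so `k` is chosen after it, making `C ^ p * T / k ≤ 1 / (n +
    -- 1)`.
    obtain ⟨k, hk⟩ := exists_nat_gt (C ^ p * T * (n + 1))
    have hk0 : (0 : ℝ≥0) < k := zero_le.trans_lt hk
    obtain ⟨ζ, hζ, hle⟩ := hC k (by exact_mod_cast hk0)
    refine ⟨ζ, hζ, (upperExpectation_stoppedIndicator_sub_le Ps hp T τ X (Y n) ζ C (T / k)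
      (by simpa using hle)).trans ?_⟩
    gcongr
    have hn : (0 : ℝ≥0) < n + 1 := by positivity
    have : C ^ p * (T / k) ≤ ((n : ℝ≥0) + 1)⁻¹ := by
      rw [← mul_div_assoc, div_le_iff₀ hk0, inv_mul_eq_div, le_div_iff₀ hn]
      exact hk.le
    rw [← ENNReal.coe_rpow_of_nonneg _ hp0.le, ← ENNReal.coe_mul]
    refine (ENNReal.coe_le_coe.2 this).trans_eq ?_
    rw [ENNReal.coe_inv hn.ne']
    simp
  choose ζ hζ hle using hex
  refine ⟨ζ, hζ, ?_⟩
  have hinv : Tendsto (fun n : ℕ => ((n : ℝ≥0∞) + 1)⁻¹) atTop (𝓝 0) := by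
    simpa using (tendsto_add_atTop_iff_nat 1).2 ENNReal.tendsto_inv_nat_nhds_zero
  have hbound := ENNReal.Tendsto.const_mul (ha.add hinv) (Or.inr h2)
  rw [add_zero, mul_zero] at hbound
  have hroot := ((ENNReal.continuous_rpow_const (y := 1 / p)).tendsto 0).comp hbound
  rw [ENNReal.zero_rpow_of_pos (one_div_pos.2 hp0)] at hroot
  refine tendsto_of_tendsto_of_tendsto_of_le_of_le tendsto_const_nhds hroot
    (fun _ => zero_le) fun n => ?_
  exact ENNReal.rpow_le_rpow (hle n) (by positivity)
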